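/- **Theorem 4.5.** Every unital simple TAI $C^*$-algebra $A$ has stable rank one, that is, the invertible elements of $A$ are dense in $A$. Here $A$ is *simple* if it is nonzero and has no closed two-sided ideals other than $0$ and $A$. An element of $A$ is *full* if the closed two-sided ideal it generates is $A$. For projections, $p\sim q$ is Murray–von Neumann equivalence, i.e. $p=v^*v$, $q=vv^*$ for some $v\in A$; $p\preceq q$ means that $p$ is equivalent to a projection in $qAq$; $n[e]\le[p]$ means that $pAp$ contains $n$ mutually orthogonal projections, each equivalent to $e$; and, for $a\in A_+$, $p\preceq a$ means that $p\preceq q$ for some projection $q\in\overline{aAa}$. For $x\in A$, $S\subset A$, $\varepsilon>0$, $x\in_\varepsilon S$ means that $\|x-y\|<\varepsilon$ for some $y\in S$. Let $\mathcal I$ be the class of $C^*$-algebras isomorphic to a finite direct sum $\bigoplus_{i=1}^m B_i$ ($m\ge1$), where each $B_i$ is $M_k(\mathbb C)$ or $M_k(C([0,1]))$ for some integer $k\ge1$ depending on $i$. A unital $C^*$-algebra $A$ is *tracially approximately interval* (TAI) if for every finite subset $\mathcal F\subset A$ containing a nonzero element $b$, every $\varepsilon>0$, every integer $n>0$ and every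 full element $a\in A_+$, there exist a nonzero projection $p\in A$ and a $C^*$-subalgebra $I\subset A$ with $I\in\mathcal I$ and $1_I=p$ such that 1. $\|xp-px\|<\varepsilon$ for all $x\in\mathcal F$; 2. $pxp\in_\varepsilon I$ for all $x\in\mathcal F$, and $\|pbp\|\ge\|b\|-\varepsilon$; 3. $n[1-p]\le[p]$ and $1-p\preceq a$. -/

import Mathlib

namespace TracialAI

section Projections

variable {A : Type*} [NonUnitalRing A] [StarRing A]

/-- Murray-von Neumann equivalence of projections: `p = v* v` and `q = v v*` for some `v`. -/
def MvNEquiv (p q : A) : Prop :=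
  ∃ v : A, star v * v = p ∧ v * star v = q

/-- `p ≼ q` for projections: `p` is Murray-von Neumann equivalent to a projection in `qAq`. -/
def MvNSub (p q : A) : Prop :=
  ∃ q' : A, IsStarProjection q' ∧ (∃ x : A, q' = q * x * q) ∧ MvNEquiv p q'

/-- `n[e] ≤ [p]` for projections: `pAp` contains `n` mutually orthogonal projections, each of them
Murray-von Neumann equivalent to `e`. -/
def MvNSubMultiple (n : ℕ) (e p : A) : Prop :=
  ∃ q : Fin n → A,
    (∀ i, IsStarProjection (q i) ∧ (∃ x : A, q i = p * x * p) ∧ MvNEquiv e (q i)) ∧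
      ∀ i j, i ≠ j → q i * q j = 0

/-- `p ≼ a` for a projection `p` and a positive element `a`: `p ≼ q` for some projection `q` in the
hereditary subalgebra, the closure of `aAa`. -/
def MvNSubPositive [TopologicalSpace A] (p a : A) : Prop :=
  ∃ q : A, IsStarProjection q ∧ q ∈ closure (Set.range fun x : A => a * x * a) ∧ MvNSub p q

end Projections

/-- The class of interval algebras: finite direct sums, with at least one summand, of algebras
`M_k(ℂ)` and `M_k(C([0,1]))`, `k ≥ 1`, up to *-isomorphism. The summands of the two kinds are
listed separately; either list may be empty. -/
def IsIntervalAlgebra (B : Type*) [NonUnitalCStarAlgebra B] : Prop :=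
  ∃ (m l : ℕ) (r : Fin m → ℕ) (s : Fin l → ℕ),
    0 < m + l ∧ (∀ i, 0 < r i) ∧ (∀ j, 0 < s j) ∧
      Nonempty (B ≃⋆ₐ[ℂ]
        ((∀ i, CStarMatrix (Fin (r i)) (Fin (r i)) ℂ) ×
          (∀ j, CStarMatrix (Fin (s j)) (Fin (s j)) C(unitInterval, ℂ))))

/-- A C*-algebra is simple if it is nonzero and has no closed two-sided ideals besides `0` and
itself. -/
def IsSimpleCStar (A : Type*) [CStarAlgebra A] : Prop :=
  Nontrivial A ∧ ∀ J : TwoSidedIdeal A, IsClosed (J : Set A) → J = ⊥ ∨ J = ⊤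

/-- An element is full if no proper closed two-sided ideal contains it. -/
def IsFull {A : Type*} [CStarAlgebra A] (a : A) : Prop :=
  ∀ J : TwoSidedIdeal A, IsClosed (J : Set A) → a ∈ J → J = ⊤

/-- `x ∈_ε S`: some element of `S` has distance less than `ε` from `x`. -/
def ApproxMem {A : Type*} [CStarAlgebra A] (ε : ℝ) (x : A) (S : Set A) : Prop :=
  ∃ y ∈ S, ‖x - y‖ < ε

/-- Unital tracially approximately interval (TAI) C*-algebras. The C*-subalgebra `I` has unit `p`,
which need not be the unit of `A`. -/
def IsTAI (A : Type*) [CStarAlgebra A] [PartialOrder A] [StarOrderedRing A] : Prop :=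
  ∀ (F : Finset A) (b : A), b ∈ F → b ≠ 0 →
  ∀ ε : ℝ, 0 < ε → ∀ n : ℕ, 0 < n → ∀ a : A, 0 ≤ a → IsFull a →
    ∃ p : A, IsStarProjection p ∧ p ≠ 0 ∧
    ∃ (I : NonUnitalStarSubalgebra ℂ A) (_ : IsClosed (I : Set A)),
      IsIntervalAlgebra I ∧ p ∈ I ∧ (∀ x ∈ I, p * x = x ∧ x * p = x) ∧
      (∀ x ∈ F, ‖x * p - p * x‖ < ε) ∧
      (∀ x ∈ F, ApproxMem ε (p * x * p) (I : Set A)) ∧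
      ‖b‖ - ε ≤ ‖p * b * p‖ ∧
      MvNSubMultiple n (1 - p) p ∧
      MvNSubPositive (1 - p) a

/-- A unital C*-algebra has stable rank one if its invertible elements are dense. -/
def HasStableRankOne (A : Type*) [CStarAlgebra A] : Prop :=
  Dense {a : A | IsUnit a}

end TracialAI

/-!
Let `A` be unital, simple and TAI, and let `a ∈ A` be non-invertible. Then `star a * a` or
`a * star a` is not invertible, and since the closure of the invertible elements is closed under
`star`, it is enough to treat the first case.

Interval algebras have stable rank one: this holds for `C([0,1])` as a generic small translate of
a smooth plane curve avoids `0`, and it passes to matrices by Schur complements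
(`dense_isUnit_matrix`) and to corners (`exists_corner_invertible_near`). Compressing `a` to an
interval algebra `I ⊆ A` on which the non-invertibility of `a` is still visible, and taking the
polar decomposition there, one finds a unitary `u` such that `star u * a` is close to an element
`c` with `c k = k c = 0` for some nonzero `k ≥ 0` (`exists_unitary_mul_near_annihilated`).

If the hereditary subalgebra of `k` contains no nonzero projection, the TAI property for the full
element `k` forces the unit `p` of the approximating interval algebra to be `1`, so that `c` is
close to an invertible element of that algebra. Otherwise `c e = e c = 0` for a nonzero projection
`e`, and the TAI property is applied to the full element `e`: up to small errors `c` is the sum of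
an element of a corner of `I`, which can be made invertible there, and of an element of a corner
whose unit is subequivalent to `e`. The second summand is completed to an invertible element by
swapping its corner with a part of `e` (`isUnit_of_corner_swap`,
`mem_closure_isUnit_of_mul_projection_eq_zero`).
-/

namespace TracialAI

/-! ### Density of invertible elements in interval algebras -/

/-- A polynomial approximation of a function on the interval extends to a smooth curve `ℝ → ℂ`,
which misses arbitrarily small constants `z`; subtracting such a `z` makes it nowhere zero. -/
theorem dense_isUnit_continuousMap_unitInterval : Dense {f : C(unitInterval, ℂ) | IsUnit f} := by
  rw [Metric.dense_iff]
  intro f ε hε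
  obtain ⟨P, hP⟩ := exists_polynomial_near_continuousMap 0 1
    (⟨fun t => (f t).re, by fun_prop⟩ : C(Set.Icc (0 : ℝ) 1, ℝ)) (ε / 4) (by positivity)
  obtain ⟨Q, hQ⟩ := exists_polynomial_near_continuousMap 0 1
    (⟨fun t => (f t).im, by fun_prop⟩ : C(Set.Icc (0 : ℝ) 1, ℝ)) (ε / 4) (by positivity)
  let g : ℝ → ℂ := fun t => ((P.eval t : ℝ) : ℂ) + ((Q.eval t : ℝ) : ℂ) * Complex.I
  have hg : ContDiff ℝ 1 g := by
    have h (P : Polynomial ℝ) : ContDiff ℝ 1 fun t : ℝ => ((P.eval t : ℝ) : ℂ) :=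
      Complex.ofRealCLM.contDiff.comp (by simpa using P.contDiff_aeval (R := ℝ) (𝕜 := ℝ) 1)
    exact (h P).add ((h Q).mul contDiff_const)
  obtain ⟨z, hz, hzg⟩ := (hg.dense_compl_range_of_finrank_lt_finrank
    (by simp [Complex.finrank_real_complex])).exists_dist_lt 0 (show 0 < ε / 4 by positivity)
  refine ⟨⟨fun t => g t - z, by have := hg.continuous; fun_prop⟩, ?_, ?_⟩
  · rw [Metric.mem_ball, ContinuousMap.dist_lt_iff hε]
    intro t
    have h1 := (ContinuousMap.norm_coe_le_norm _ t).trans_lt hP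
    have h2 := (ContinuousMap.norm_coe_le_norm _ t).trans_lt hQ
    simp only [ContinuousMap.coe_sub, Pi.sub_apply, ContinuousMap.coe_mk,
      Polynomial.toContinuousMapOn_apply, Polynomial.toContinuousMap_apply] at h1 h2
    rw [dist_zero_left] at hzg
    have key : g t - z - f t = (((P.eval (t : ℝ) - (f t).re : ℝ) : ℂ)
        + ((Q.eval (t : ℝ) - (f t).im : ℝ) : ℂ) * Complex.I) - z := by
      conv_lhs => rw [← Complex.re_add_im (f t)]
      simp only [g]
      push_cast
      ring
    rw [dist_eq_norm]
    change ‖g t - z - f t‖ < ε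
    rw [key]
    refine (norm_sub_le _ _).trans_lt ?_
    have := norm_add_le (((P.eval (t : ℝ) - (f t).re : ℝ) : ℂ))
      (((Q.eval (t : ℝ) - (f t).im : ℝ) : ℂ) * Complex.I)
    rw [norm_mul, Complex.norm_I, mul_one, Complex.norm_real, Complex.norm_real] at this
    linarith
  · rw [Set.mem_ofPred_eq, ContinuousMap.isUnit_iff_forall_ne_zero]
    intro t ht
    exact hz ⟨t, sub_eq_zero.mp ht⟩

/-- Induction on `n` with Schur complements: perturb the upper left `n × n` block to an invertible
matrix, then perturb the Schur complement, a `1 × 1` block. -/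
theorem dense_isUnit_matrix {R : Type*} [CommRing R] [TopologicalSpace R] [IsTopologicalRing R]
    (hR : Dense {a : R | IsUnit a}) (n : ℕ) :
    Dense {M : Matrix (Fin n) (Fin n) R | IsUnit M} := by
  induction n with
  | zero =>
    intro M
    exact subset_closure (isUnit_of_subsingleton M)
  | succ n ih =>
    have hone : Dense {M : Matrix (Fin 1) (Fin 1) R | IsUnit M} := by
      have hs : Function.Surjective
          fun r : R => (Matrix.of fun _ _ => r : Matrix (Fin 1) (Fin 1) R) :=
        fun M => ⟨M 0 0, by ext i j; fin_cases i; fin_cases j; rfl⟩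
      refine (hs.denseRange.dense_image (by fun_prop) hR).mono ?_
      rintro _ ⟨r, hr, rfl⟩
      simpa [Matrix.isUnit_iff_isUnit_det] using hr
    rw [dense_iff_inter_open]
    rintro U hU ⟨M, hM⟩
    let e := Matrix.reindexAlgEquiv R R (finSumFinEquiv (m := n) (n := 1))
    have he : Continuous e := by
      refine continuous_matrix fun i j => ?_
      simp only [e, Matrix.coe_reindexAlgEquiv, Matrix.reindex_apply, Matrix.submatrix_apply]
      fun_prop
    obtain ⟨N, rfl⟩ := e.surjective M
    obtain ⟨A, B, C, D, rfl⟩ : ∃ A B C D, N = Matrix.fromBlocks A B C D :=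
      ⟨_, _, _, _, (Matrix.fromBlocks_toBlocks N).symm⟩
    obtain ⟨A', hA', hAu⟩ := ih.inter_open_nonempty
      ((fun A' => e (Matrix.fromBlocks A' B C D)) ⁻¹' U) (hU.preimage (by fun_prop)) ⟨A, hM⟩
    obtain ⟨S, hS, hSu⟩ := hone.inter_open_nonempty
      ((fun S => e (Matrix.fromBlocks A' B C (S + C * A'⁻¹ * B))) ⁻¹' U) (hU.preimage (by fun_prop))
      ⟨D - C * A'⁻¹ * B, by simpa using hA'⟩
    refine ⟨_, hS, ?_⟩
    have hAu' : IsUnit A' := hAu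
    let _ := hAu'.invertible
    refine IsUnit.map e ?_
    rw [Matrix.isUnit_fromBlocks_iff_of_invertible₁₁, Matrix.invOf_eq_nonsing_inv,
      add_sub_cancel_right]
    exact hSu

theorem dense_isUnit_cStarMatrix {R : Type*} [CommCStarAlgebra R] (hR : Dense {a : R | IsUnit a})
    (n : ℕ) : Dense {M : CStarMatrix (Fin n) (Fin n) R | IsUnit M} := by
  refine (CStarMatrix.ofMatrix.surjective.denseRange.dense_image
    CStarMatrix.uniformEmbedding_ofMatrix.uniformContinuous.continuous
    (dense_isUnit_matrix hR n)).mono ?_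
  rintro _ ⟨M, hM, rfl⟩
  exact IsUnit.map CStarMatrix.ofMatrixRingEquiv hM

theorem dense_isUnit_pi {ι : Type*} {R : ι → Type*} [∀ i, Monoid (R i)]
    [∀ i, TopologicalSpace (R i)] (h : ∀ i, Dense {a : R i | IsUnit a}) :
    Dense {a : ∀ i, R i | IsUnit a} := by
  refine (dense_pi Set.univ fun i _ => h i).mono fun a ha => ?_
  exact Pi.isUnit_iff.mpr fun i => ha i trivial

/-- An interval subalgebra `I` of `A` has stable rank one relative to its own unit `p`. -/
theorem IsIntervalAlgebra.exists_near_invertible {A : Type*} [CStarAlgebra A]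
    {I : NonUnitalStarSubalgebra ℂ A} (hIc : IsClosed (I : Set A)) (hI : IsIntervalAlgebra I)
    {p : A} (hp : p ∈ I) (hpI : ∀ x ∈ I, p * x = x ∧ x * p = x) {x : A} (hx : x ∈ I)
    {δ : ℝ} (hδ : 0 < δ) :
    ∃ y ∈ I, ∃ z ∈ I, y * z = p ∧ z * y = p ∧ ‖x - y‖ < δ := by
  obtain ⟨m, l, r, s, -, -, -, ⟨φ⟩⟩ := hI
  have hd := (dense_isUnit_pi fun i => dense_isUnit_cStarMatrix (R := ℂ)
      ((dense_compl_singleton (0 : ℂ)).mono fun _ => IsUnit.mk0 _) (r i)).prod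
    (dense_isUnit_pi fun i => dense_isUnit_cStarMatrix
      dense_isUnit_continuousMap_unitInterval (s i))
  have hφ : Continuous φ.symm := by
    let _ := CStarAlgebra.spectralOrder ℂ
    have _ := CStarAlgebra.spectralOrderedRing ℂ
    let _ := CStarAlgebra.spectralOrder C(unitInterval, ℂ)
    have _ := CStarAlgebra.spectralOrderedRing C(unitInterval, ℂ)
    exact (NonUnitalStarAlgHom.isometry φ.symm φ.symm.injective).continuous
  obtain ⟨v, hv, hvu⟩ := hd.inter_open_nonempty
    ((fun v => ((φ.symm v : I) : A)) ⁻¹' Metric.ball x δ)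
    (Metric.isOpen_ball.preimage (by fun_prop)) ⟨φ ⟨x, hx⟩, by simpa using hδ⟩
  obtain ⟨w, hvw, hwv⟩ : ∃ w, v * w = 1 ∧ w * v = 1 := by
    obtain ⟨w, rfl⟩ := Prod.isUnit_iff.mpr hvu
    exact ⟨_, w.mul_inv, w.inv_mul⟩
  have hone : ((φ.symm 1 : I) : A) = p := by
    have h : φ ⟨p, hp⟩ = 1 := by
      rw [← mul_one (φ ⟨p, hp⟩)]
      obtain ⟨o, ho : φ o = 1⟩ := φ.surjective 1
      rw [← ho, ← map_mul]
      congr 1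
      exact Subtype.ext (hpI o o.2).1
    rw [← h, φ.symm_apply_apply]
  refine ⟨_, (φ.symm v).2, _, (φ.symm w).2, ?_, ?_, ?_⟩
  · rw [← hone, ← hvw, map_mul]; rfl
  · rw [← hone, ← hwv, map_mul]; rfl
  · simpa [dist_eq_norm, norm_sub_rev] using hv

/-! ### Almost projections and inverses in corners -/

/-- A selfadjoint element `x` that is almost idempotent is close to a projection, which can be
written `x * g` with `g` commuting with `x`. The factor `x` shows at once that every left or right
unit of `x` is one for the projection. -/
theorem exists_isStarProjection_near {B : Type*} [NonUnitalCStarAlgebra B] {x : B}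
    (hx : IsSelfAdjoint x) {η : ℝ} (hη : ‖x * x - x‖ ≤ η) (hη' : η ≤ 1 / 6) :
    ∃ g : B, IsStarProjection (x * g) ∧ Commute x g ∧ ‖x * g - x‖ ≤ 2 * η := by
  let f : ℝ → ℝ := fun t => min 1 (max 0 (3 * t - 1))
  let G : ℝ → ℝ := fun t => f t / max t (1 / 3)
  have hm : ∀ t : ℝ, max t (1 / 3) ≠ 0 := fun t => (lt_max_of_lt_right (by norm_num)).ne'
  have hf : Continuous f := by fun_prop
  have hG : Continuous G := hf.div₀ (by fun_prop) hm
  have hf0 : f 0 = 0 := by norm_num [f]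
  have hG0 : G 0 = 0 := by simp [G, hf0]
  have hlow : ∀ t : ℝ, t ≤ 1 / 3 → f t = 0 := fun t ht => by
    simp only [f]
    rw [max_eq_left (by linarith), min_eq_right zero_le_one]
  have hhigh : ∀ t : ℝ, 2 / 3 ≤ t → f t = 1 := fun t ht => by
    simp only [f]
    rw [max_eq_right (by linarith), min_eq_left (by linarith)]
  have hfG : ∀ t, t * G t = f t := fun t => by
    rcases le_total t (1 / 3) with h | h
    · simp [G, hlow t h]
    · simp only [G]
      rw [max_eq_left h]
      have : t ≠ 0 := by linarith
      field_simp
  have hspec : ∀ t ∈ quasispectrum ℝ x, |t * t - t| ≤ η := fun t ht => by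
    refine le_trans ?_ hη
    have h := norm_apply_le_norm_cfcₙ (fun s : ℝ => s * s - s) x ht (by fun_prop) (by simp) hx
    rwa [cfcₙ_sub (fun s : ℝ => s * s) (fun s : ℝ => s) x (by fun_prop) (by simp) (by fun_prop) rfl,
      cfcₙ_mul (fun s : ℝ => s) (fun s : ℝ => s) x (by fun_prop) rfl (by fun_prop) rfl,
      cfcₙ_id' ℝ x hx] at h
  -- The spectrum avoids the interval on which `f` interpolates between `0` and `1`.
  have hgap : ∀ t ∈ quasispectrum ℝ x, t ≤ 1 / 3 ∨ 2 / 3 ≤ t := fun t ht => by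
    by_contra! h
    have := (abs_le.mp (hspec t ht)).1
    nlinarith
  have hxG : x * cfcₙ G x = cfcₙ f x := by
    nth_rw 1 [← cfcₙ_id' ℝ x]
    rw [← cfcₙ_mul (fun t : ℝ => t) G x continuousOn_id rfl hG.continuousOn hG0]
    exact cfcₙ_congr fun t _ => hfG t
  refine ⟨cfcₙ G x, ?_, ?_, ?_⟩
  · rw [hxG]
    refine ⟨?_, cfcₙ_predicate f x⟩
    rw [IsIdempotentElem, ← cfcₙ_mul f f x hf.continuousOn hf0 hf.continuousOn hf0]
    refine cfcₙ_congr fun t ht => ?_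
    rcases hgap t ht with h | h
    · simp [hlow t h]
    · simp [hhigh t h]
  · have := cfcₙ_commute_cfcₙ (fun t : ℝ => t) G x
    rwa [cfcₙ_id' ℝ x hx] at this
  · rw [hxG]
    nth_rw 2 [← cfcₙ_id' ℝ x]
    rw [← cfcₙ_sub f (fun t : ℝ => t) x hf.continuousOn hf0 continuousOn_id rfl]
    refine norm_cfcₙ_le fun t ht => ?_
    have h1 := hspec t ht
    rw [Real.norm_eq_abs]
    rw [show t * t - t = t * (t - 1) by ring, abs_mul] at h1
    rcases hgap t ht with h | h
    · rw [hlow t h, zero_sub, abs_neg]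
      have : 1 / 2 ≤ |t - 1| := by rw [abs_of_nonpos (by linarith)]; linarith
      nlinarith [abs_nonneg t]
    · rw [hhigh t h, abs_sub_comm]
      have : 1 / 2 ≤ |t| := by rw [abs_of_nonneg (by linarith)]; linarith
      nlinarith [abs_nonneg (t - 1)]

theorem norm_mul_le_of_norm_le_one_left {A : Type*} [NonUnitalNormedRing A] {a : A} (ha : ‖a‖ ≤ 1)
    (b : A) : ‖a * b‖ ≤ ‖b‖ :=
  (norm_mul_le a b).trans (mul_le_of_le_one_left (norm_nonneg b) ha)

theorem norm_mul_le_of_norm_le_one_right {A : Type*} [NonUnitalNormedRing A] (a : A) {b : A}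
    (hb : ‖b‖ ≤ 1) : ‖a * b‖ ≤ ‖a‖ :=
  (norm_mul_le a b).trans (mul_le_of_le_one_right (norm_nonneg a) hb)

theorem mul_star_mul_self_of_isStarProjection {A : Type*} [CStarAlgebra A] {v : A}
    (hv : IsStarProjection (star v * v)) : v * star v * v = v := by
  rw [← sub_eq_zero, ← CStarRing.star_mul_self_eq_zero_iff]
  have h := hv.isIdempotentElem.eq
  simp only [star_sub, star_mul, star_star, sub_mul, mul_sub, mul_assoc] at h ⊢
  simp only [h, sub_self]

theorem norm_le_one_of_isStarProjection_star_mul_self {A : Type*} [CStarAlgebra A] {v : A}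
    (hv : IsStarProjection (star v * v)) : ‖v‖ ≤ 1 := by
  have h := hv.norm_le
  rw [CStarRing.norm_star_mul_self] at h
  nlinarith [norm_nonneg v]

/-- An element of the corner `e A e` that is close to `e` is invertible in `e A e`. -/
theorem exists_corner_inverse {A : Type*} [CStarAlgebra A] {e w : A} (he : IsStarProjection e)
    (hew : e * w = w) (hwe : w * e = w) (h : ‖w - e‖ ≤ 1 / 2) :
    ∃ d : A, e * d = d ∧ d * e = d ∧ w * d = e ∧ d * w = e ∧ ‖d‖ ≤ 2 := by
  have hee := he.isIdempotentElem.eq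
  let u : Aˣ := Units.oneSub (e - w) (by rw [norm_sub_rev]; linarith)
  have hu : (u : A) = 1 - (e - w) := rfl
  have hcomm : Commute e (↑u⁻¹ : A) := by
    refine Commute.units_inv_right ?_
    rw [Commute, SemiconjBy, hu]
    simp only [mul_sub, sub_mul, mul_one, one_mul, hee, hew, hwe]
  have hue : (u : A) * e = w := by rw [hu]; simp [sub_mul, hee, hwe]
  have hwd : w * (↑u⁻¹ * e) = e := by
    rw [← hcomm.eq, ← mul_assoc, hwe, ← hue, mul_assoc, hcomm.eq, ← mul_assoc, u.mul_inv, one_mul]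
  have hed : e * (↑u⁻¹ * e) = ↑u⁻¹ * e := by rw [← mul_assoc, hcomm.eq, mul_assoc, hee]
  refine ⟨↑u⁻¹ * e, hed, ?_, hwd, ?_, ?_⟩
  · rw [mul_assoc, hee]
  · rw [mul_assoc, hew, ← hue, ← mul_assoc, u.inv_mul, one_mul]
  · set d := (↑u⁻¹ : A) * e
    have hd : d = e - (w - e) * d := by rw [sub_mul, hwd, hed, sub_sub_cancel]
    have h1 := norm_sub_le e ((w - e) * d)
    rw [← hd] at h1
    have h2 := norm_mul_le (w - e) d
    have h3 := mul_le_mul_of_nonneg_right h (norm_nonneg d)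
    linarith [he.norm_le]

/-! ### Invertible elements from corners -/

/-- Stable rank one passes to corners: if `x` lies in `r A r` and `x + e` is close to an element
`Y` with inverse `Z` relative to the unit `r + e`, then `x` is close to an invertible element of
`r A r`, the Schur complement of `e Y e` in `Y`. Its inverse is `r Z r`. -/
theorem exists_corner_invertible_near {A : Type*} [CStarAlgebra A] {r e x Y Z : A}
    (hr : IsStarProjection r) (he : IsStarProjection e) (hre : r * e = 0) (her : e * r = 0)
    (hrx : r * x = x) (hxr : x * r = x) (hYp : Y * (r + e) = Y) (hZp : Z * (r + e) = Z)
    (hYZ : Y * Z = r + e) (hZY : Z * Y = r + e)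
    {η : ℝ} (hη : ‖Y - (x + e)‖ ≤ η) (hη' : η ≤ 1 / 2) :
    ∃ y z : A, r * y = y ∧ y * r = y ∧ r * z = z ∧ z * r = z ∧ y * z = r ∧ z * y = r ∧
      ‖y - x‖ ≤ η + 2 * η ^ 2 := by
  have hrr := hr.isIdempotentElem.eq
  have hee := he.isIdempotentElem.eq
  have hex : e * x = 0 := by rw [← hrx, ← mul_assoc, her, zero_mul]
  have hxe : x * e = 0 := by rw [← hxr, mul_assoc, hre, mul_zero]
  have hη0 : 0 ≤ η := (norm_nonneg _).trans hη
  obtain ⟨d, hed, hde, hwd, hdw, hd⟩ := exists_corner_inverse (w := e * Y * e) he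
    (by rw [← mul_assoc, ← mul_assoc, hee]) (by rw [mul_assoc, hee]) (by
      have : e * Y * e - e = e * (Y - (x + e)) * e := by
        simp only [mul_sub, sub_mul, mul_add, hex, hee, zero_add]
      rw [this]
      exact ((norm_mul_le_of_norm_le_one_right _ he.norm_le).trans
        (norm_mul_le_of_norm_le_one_left he.norm_le _)).trans (hη.trans hη'))
  have hrd : r * d = 0 := by rw [← hed, ← mul_assoc, hre, zero_mul]
  have hdr : d * r = 0 := by rw [← hde, mul_assoc, her, mul_zero]
  have hdYe : d * Y * e = e := by
    rw [← hde, mul_assoc, mul_assoc, ← mul_assoc e, hdw]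
  have heYd : e * Y * d = e := by
    rw [← hed, ← mul_assoc, hwd]
  refine ⟨r * Y * r - r * Y * d * Y * r, r * Z * r, ?_, ?_, ?_, ?_, ?_, ?_, ?_⟩
  · simp only [mul_sub, ← mul_assoc, hrr]
  · simp only [sub_mul, mul_assoc, hrr]
  · simp only [← mul_assoc, hrr]
  · simp only [mul_assoc, hrr]
  · have h1 : Y * r * Z = r + e - Y * e * Z := by
      rw [eq_sub_iff_add_eq, ← add_mul, ← mul_add, hYp, hYZ]
    have h2 : r * Y * r * Z * r = r - r * Y * e * Z * r := by
      calc r * Y * r * Z * r = r * (Y * r * Z) * r := by noncomm_ring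
        _ = r * r * r + r * e * r - r * Y * e * Z * r := by rw [h1]; noncomm_ring
        _ = _ := by rw [hre, hrr, hrr]; simp
    have h3 : r * Y * d * Y * r * Z * r = - (r * Y * e * Z * r) := by
      calc r * Y * d * Y * r * Z * r = r * Y * d * (Y * r * Z) * r := by noncomm_ring
        _ = r * Y * (d * r) * r + r * Y * (d * e) * r - r * Y * (d * Y * e) * Z * r := by
          rw [h1]; noncomm_ring
        _ = _ := by
          rw [hdr, hde, hdYe, ← hde, mul_assoc _ (d * e), mul_assoc d, her]; simp
    calc (r * Y * r - r * Y * d * Y * r) * (r * Z * r)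
        = r * Y * (r * r) * Z * r - r * Y * d * Y * (r * r) * Z * r := by noncomm_ring
      _ = r := by rw [hrr, h2, h3]; simp
  · have h1 : Z * r * Y = r + e - Z * e * Y := by
      rw [eq_sub_iff_add_eq, ← add_mul, ← mul_add, hZp, hZY]
    have h2 : r * Z * r * Y * r = r - r * Z * e * Y * r := by
      calc r * Z * r * Y * r = r * (Z * r * Y) * r := by noncomm_ring
        _ = r * r * r + r * e * r - r * Z * e * Y * r := by rw [h1]; noncomm_ring
        _ = _ := by rw [hre, hrr, hrr]; simp
    have h3 : r * Z * r * Y * d * Y * r = - (r * Z * e * Y * r) := by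
      calc r * Z * r * Y * d * Y * r = r * (Z * r * Y) * d * Y * r := by noncomm_ring
        _ = r * (r * d) * Y * r + (r * e) * d * Y * r - r * Z * (e * Y * d) * Y * r := by
          rw [h1]; noncomm_ring
        _ = _ := by rw [hrd, hre, heYd]; simp
    calc r * Z * r * (r * Y * r - r * Y * d * Y * r)
        = r * Z * (r * r) * Y * r - r * Z * (r * r) * Y * d * Y * r := by noncomm_ring
      _ = r := by rw [hrr, h2, h3]; simp
  · have h1 : r * Y * r - r * Y * d * Y * r - x
        = r * (Y - (x + e)) * r - (r * (Y - (x + e)) * e) * d * (e * (Y - (x + e)) * r) := by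
      have h2 : r * (Y - (x + e)) * r = r * Y * r - x := by
        simp only [mul_sub, sub_mul, mul_add, add_mul, hrx, hxr, hre]; simp
      have h3 : r * (Y - (x + e)) * e = r * Y * e := by
        simp only [mul_sub, sub_mul, mul_add, add_mul, hrx, hxe, hre]; simp
      have h4 : e * (Y - (x + e)) * r = e * Y * r := by
          simp only [mul_sub, sub_mul, mul_add, add_mul, hex, hee, her]; simp
      rw [h2, h3, h4, mul_assoc _ e d, hed, ← mul_assoc, ← mul_assoc, mul_assoc _ d e, hde]
      abel
    have hb : ∀ a b : A, ‖a‖ ≤ 1 → ‖b‖ ≤ 1 → ‖a * (Y - (x + e)) * b‖ ≤ η := fun a b ha hb =>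
      ((norm_mul_le_of_norm_le_one_right _ hb).trans
        (norm_mul_le_of_norm_le_one_left ha _)).trans hη
    rw [h1]
    refine (norm_sub_le _ _).trans (add_le_add (hb r r hr.norm_le hr.norm_le) ?_)
    calc _ ≤ ‖r * (Y - (x + e)) * e‖ * ‖d‖ * ‖e * (Y - (x + e)) * r‖ := norm_mul₃_le
      _ ≤ η * 2 * η := by
        gcongr
        · exact hb r e hr.norm_le he.norm_le
        · exact hb e r he.norm_le hr.norm_le
      _ = _ := by ring

/-- Let `1 = r + s + e` be an orthogonal decomposition, `y` invertible in the `r`-corner, and let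
`V`, `W` embed `s` into `e`, in the sense that `W V = s`. Then an arbitrary element `C` of the
`s`-corner can be completed to an invertible element by an off-diagonal term that swaps `s` with
the idempotent `V W` of the `e`-corner; the matrix behind this is `!![C, δ; δ, 0]`. -/
theorem isUnit_of_corner_swap {A : Type*} [Ring A] [Algebra ℂ A] {e r s y z C V W : A}
    (hee : e * e = e) (hes : e * s = 0) (hse : s * e = 0) (her : e * r = 0) (hre : r * e = 0)
    (hrs : r * s = 0) (hsr : s * r = 0) (hsum : r + s + e = 1)
    (hry : r * y = y) (hyr : y * r = y) (hrz : r * z = z) (hzr : z * r = z)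
    (hyz : y * z = r) (hzy : z * y = r) (hsC : s * C = C) (hCs : C * s = C)
    (heV : e * V = V) (hVs : V * s = V) (hsW : s * W = W) (hWe : W * e = W) (hWV : W * V = s)
    {δ : ℂ} (hδ : δ ≠ 0) :
    IsUnit (y + C + δ • (V + W) + δ • (e - V * W)) := by
  -- Products of elements whose inner corners are orthogonal vanish.
  have key : ∀ {a b c d : A}, a * b = a → c * d = d → b * c = 0 → a * d = 0 := by
    intro a b c d h1 h2 h3
    rw [← h1, ← h2, mul_assoc, ← mul_assoc b, h3, zero_mul, mul_zero]
  have ss : ∀ {a d : A}, a * d = 0 → ∀ x, a * (d * x) = 0 := fun h x => by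
    rw [← mul_assoc, h, zero_mul]
  have tt : ∀ {a d f : A}, a * d = f → ∀ x, a * (d * x) = f * x := fun h x => by
    rw [← mul_assoc, h]
  have yV := key hyr heV hre
  have yW := key hyr hsW hrs
  have ye := key hyr hee hre
  have zC := key hzr hsC hrs
  have zV := key hzr heV hre
  have zW := key hzr hsW hrs
  have ze := key hzr hee hre
  have Cz := key hCs hrz hsr
  have CV := key hCs heV hse
  have Ce := key hCs hee hse
  have Vy := key hVs hry hsr
  have Vz := key hVs hrz hsr
  have VV := key hVs heV hse
  have Ve := key hVs hee hse
  have Wy := key hWe hry her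
  have Wz := key hWe hrz her
  have WW := key hWe hsW hes
  have WC := key hWe hsC hes
  have ey := key hee hry her
  have ez := key hee hrz her
  have eC := key hee hsC hes
  have eW := key hee hsW hes
  refine isUnit_iff_exists.mpr ⟨z + δ⁻¹ • (V + W) - (δ⁻¹ * δ⁻¹) • (V * C * W)
    + δ⁻¹ • (e - V * W), ?_, ?_⟩
  all_goals
    rw [← hsum]
    simp only [mul_add, add_mul, mul_sub, sub_mul, smul_add, smul_sub, mul_smul_comm,
      smul_mul_assoc, smul_smul, mul_assoc, yV, yW, ye, zC, zV, zW, ze, Cz, CV, Ce, Vy, Vz, VV, Ve,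
      Wy, Wz, WW, WC, ey, ez, eC, eW, hee, hyz, hzy, heV, hWe, hWV, hCs, hVs, hsW,
      ss yV, ss zV, ss CV, ss VV, tt heV, tt hWV, tt hsC, smul_zero, mul_zero]
    have h1 : δ * δ⁻¹ = 1 := mul_inv_cancel₀ hδ
    have h2 : δ⁻¹ * δ = 1 := inv_mul_cancel₀ hδ
    have h3 : δ * (δ⁻¹ * δ⁻¹) = δ⁻¹ := by rw [← mul_assoc, h1, one_mul]
    simp only [h1, h2, h3, mul_one, one_smul]
    abel

/-! ### Elements annihilated by a projection -/

theorem IsSimpleCStar.isFull {A : Type*} [CStarAlgebra A] (hA : IsSimpleCStar A) {a : A}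
    (ha : a ≠ 0) : IsFull a := fun J hJ haJ =>
  (hA.2 J hJ).resolve_left fun h => ha (by simpa [h] using haJ)

/-- A left annihilator of `a` annihilates the hereditary subalgebra generated by `a`. -/
theorem mul_eq_zero_of_mem_closure_left {A : Type*} [CStarAlgebra A] {c a g : A} (hca : c * a = 0)
    (hg : g ∈ closure (Set.range fun x : A => a * x * a)) : c * g = 0 := by
  refine closure_minimal (t := {g | c * g = 0}) ?_ (isClosed_eq (by fun_prop) (by fun_prop)) hg
  rintro _ ⟨x, rfl⟩
  simp [← mul_assoc, hca]

/-- A right annihilator of `a` annihilates the hereditary subalgebra generated by `a`. -/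
theorem mul_eq_zero_of_mem_closure_right {A : Type*} [CStarAlgebra A] {c a g : A} (hac : a * c = 0)
    (hg : g ∈ closure (Set.range fun x : A => a * x * a)) : g * c = 0 := by
  refine closure_minimal (t := {g | g * c = 0}) ?_ (isClosed_eq (by fun_prop) (by fun_prop)) hg
  rintro _ ⟨x, rfl⟩
  simp [mul_assoc, hac]

/-- A comparison `q ≼ g` is implemented by a partial isometry with range projection below `g`. -/
theorem MvNSub.exists_star_mul_self {A : Type*} [CStarAlgebra A] {q g : A}
    (hq : IsStarProjection q) (hg : IsStarProjection g) (h : MvNSub q g) :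
    ∃ v : A, star v * v = q ∧ g * v = v := by
  obtain ⟨q', -, ⟨x, hx⟩, v, hv, hv'⟩ := h
  refine ⟨v, hv, ?_⟩
  rw [← hv] at hq
  have h1 : q' * v = v := by rw [← hv', mul_star_mul_self_of_isStarProjection hq]
  rw [← h1, hx]
  simp only [← mul_assoc, hg.isIdempotentElem.eq]

/-- An element `c` with a nonzero projection `e` as two-sided annihilator is a limit of invertible
elements. Take `I` with unit `p` almost commuting with `c` and `e`, and `q = 1 - p ≼ e`. Up to
small errors `e` splits into `e₁ ∈ I` and `e₂ ≤ q`, so that `1 = r + t + f` with `r = p - e₁`, `t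
= q - e₂`, `f = e₁ + e₂`, and `c` is block diagonal, living on `r` and `t`. The block at `r` is
close to an invertible one because `I` has stable rank one, and `t ≤ q ≼ e` makes room for the
swap of `t` with a part of `f`. -/
theorem mem_closure_isUnit_of_mul_projection_eq_zero {A : Type*} [CStarAlgebra A] [PartialOrder A]
    [StarOrderedRing A] (hsimple : IsSimpleCStar A) (hTAI : IsTAI A) {c e : A}
    (he : IsStarProjection e) (he0 : e ≠ 0) (hce : c * e = 0) (hec : e * c = 0) :
    c ∈ closure {a : A | IsUnit a} := by
  classical
  rw [Metric.mem_closure_iff]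
  intro δ hδ
  set K := ‖c‖ + 1 with hK
  have hK1 : 1 ≤ K := by linarith [norm_nonneg c]
  obtain ⟨ε, hε, hε1, hε2⟩ : ∃ ε : ℝ, 0 < ε ∧ ε ≤ 1 / 100 ∧ 100 * K * ε ≤ δ := by
    refine ⟨min (1 / 100) (δ / (100 * K)), by positivity, min_le_left _ _, ?_⟩
    calc _ ≤ 100 * K * (δ / (100 * K)) := by gcongr; exact min_le_right _ _
      _ = δ := by field_simp
  obtain ⟨p, hp, -, I, hIc, hI, hpI, hIp, hcomm, happ, -, -, hsub⟩ := hTAI {c, e} e (by simp) he0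
    ε hε 1 one_pos e he.nonneg (hsimple.isFull he0)
  set q := 1 - p with hq_def
  have hq : IsStarProjection q := hp.one_sub
  have hpp := hp.isIdempotentElem.eq
  have hqq := hq.isIdempotentElem.eq
  have hee := he.isIdempotentElem.eq
  have hpq : p * q = 0 := by rw [hq_def, mul_sub, mul_one, hpp, sub_self]
  have hqp : q * p = 0 := by rw [hq_def, sub_mul, one_mul, hpp, sub_self]
  have hcp : ‖c * p - p * c‖ ≤ ε := (hcomm c (by simp)).le
  have hep : ‖e * p - p * e‖ ≤ ε := (hcomm e (by simp)).le
  have heq : ‖e * q - q * e‖ ≤ ε := by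
    rw [norm_sub_rev]
    have : q * e - e * q = e * p - p * e := by rw [hq_def]; noncomm_ring
    rwa [this]
  have h1n : ‖(1 : A)‖ ≤ 1 := (IsStarProjection.one A).norm_le
  -- A norm bound for products with contractions on both sides.
  have hb : ∀ {a b : A} (x : A) {η : ℝ}, ‖a‖ ≤ 1 → ‖b‖ ≤ 1 → ‖x‖ ≤ η → ‖a * x * b‖ ≤ η :=
    fun x _ ha hb hx => ((norm_mul_le_of_norm_le_one_right _ hb).trans
      (norm_mul_le_of_norm_le_one_left ha _)).trans hx
  -- The projection `e₁` in `I` close to `p e p`.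
  obtain ⟨s, hs, hss, hsp⟩ : ∃ s ∈ I, IsSelfAdjoint s ∧ ‖s - p * e * p‖ ≤ ε := by
    obtain ⟨y, hy, hpy⟩ := happ e (by simp)
    refine ⟨(1 / 2 : ℂ) • (y + star y), SMulMemClass.smul_mem _ (add_mem hy (star_mem hy)), ?_, ?_⟩
    · rw [isSelfAdjoint_iff]; simp [add_comm]
    · have hx : star (p * e * p) = p * e * p := by
        simp [star_mul, hp.isSelfAdjoint.star_eq, he.isSelfAdjoint.star_eq, mul_assoc]
      have h1 : (1 / 2 : ℂ) • (y + star y) - p * e * p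
          = (1 / 2 : ℂ) • ((y - p * e * p) + star (y - p * e * p)) := by
        rw [star_sub, hx]; module
      rw [h1, norm_smul]
      have h2 := norm_add_le (y - p * e * p) (star (y - p * e * p))
      rw [norm_star, norm_sub_rev] at h2
      rw [show ‖(1 / 2 : ℂ)‖ = 1 / 2 by norm_num]
      linarith
  have hs2 : ‖s * s - s‖ ≤ 5 * ε := by
    have hx : ‖p * e * p‖ ≤ 1 := hb e hp.norm_le hp.norm_le he.norm_le
    have h1 : s * s - s = (s - p * e * p) * (s - p * e * p) + p * e * p * (s - p * e * p)
        + (s - p * e * p) * (p * e * p) - (s - p * e * p) + p * e * (p * p) * e * p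
        - p * e * p := by
      noncomm_ring
    have h2 : p * e * p * e * p - p * e * p = p * (e * p - p * e) * (e * p) := by
      have : p * (e * p - p * e) * (e * p) = p * e * p * e * p - (p * p) * (e * e) * p := by
        noncomm_ring
      rw [this, hpp, hee]
    rw [h1, hpp, add_sub_assoc, h2]
    have h3 := norm_mul_le (s - p * e * p) (s - p * e * p)
    have h4 := norm_mul_le_of_norm_le_one_left hx (s - p * e * p)
    have h5 := norm_mul_le_of_norm_le_one_right (s - p * e * p) hx
    have h6 := hb _ hp.norm_le
      ((norm_mul_le_of_norm_le_one_left he.norm_le _).trans hp.norm_le) hep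
    have h7 : ‖s - p * e * p‖ * ‖s - p * e * p‖ ≤ ε * 1 := by gcongr; linarith
    have h8 := norm_add_le ((s - p * e * p) * (s - p * e * p) + p * e * p * (s - p * e * p)
        + (s - p * e * p) * (p * e * p) - (s - p * e * p)) (p * (e * p - p * e) * (e * p))
    have h9 := norm_sub_le ((s - p * e * p) * (s - p * e * p) + p * e * p * (s - p * e * p)
        + (s - p * e * p) * (p * e * p)) (s - p * e * p)
    have h10 := norm_add₃_le (a := (s - p * e * p) * (s - p * e * p))
      (b := p * e * p * (s - p * e * p)) (c := (s - p * e * p) * (p * e * p))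
    linarith
  obtain ⟨e₁, he₁, he₁I, he₁s⟩ : ∃ e₁, IsStarProjection e₁ ∧ e₁ ∈ I ∧ ‖e₁ - s‖ ≤ 10 * ε := by
    obtain ⟨g, hg, -, hgs⟩ := exists_isStarProjection_near (B := I) (x := ⟨s, hs⟩) (η := 5 * ε)
      (Subtype.ext hss) hs2 (by linarith)
    refine ⟨_, ⟨congrArg Subtype.val hg.isIdempotentElem.eq,
      congrArg Subtype.val hg.isSelfAdjoint.star_eq⟩, (_ : I).2, ?_⟩
    calc _ ≤ 2 * (5 * ε) := hgs
      _ = _ := by ring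
  -- The projection `e₂` in `q A q` close to `q e q`.
  obtain ⟨e₂, he₂, hqe₂, he₂q, he₂s⟩ : ∃ e₂, IsStarProjection e₂ ∧ q * e₂ = e₂ ∧ e₂ * q = e₂ ∧
      ‖e₂ - q * e * q‖ ≤ 2 * ε := by
    have hx : IsSelfAdjoint (q * e * q) := by
      rw [isSelfAdjoint_iff]
      simp [star_mul, hq.isSelfAdjoint.star_eq, he.isSelfAdjoint.star_eq, mul_assoc]
    have hx2 : ‖q * e * q * (q * e * q) - q * e * q‖ ≤ ε := by
      have : q * e * q * (q * e * q) - q * e * q = q * (e * q - q * e) * (e * q) := by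
        have h1 : q * (e * q - q * e) * (e * q) = q * e * q * e * q - (q * q) * (e * e) * q := by
          noncomm_ring
        have h2 : q * e * q * (q * e * q) = q * e * (q * q) * e * q := by noncomm_ring
        rw [h1, h2, hqq, hee]
      rw [this]
      exact hb _ hq.norm_le ((norm_mul_le_of_norm_le_one_left he.norm_le _).trans hq.norm_le) heq
    obtain ⟨g, hg, hgc, hgs⟩ := exists_isStarProjection_near hx hx2 (by linarith)
    refine ⟨_, hg, ?_, ?_, hgs⟩
    · simp only [← mul_assoc, hqq]
    · rw [hgc.eq]; simp only [mul_assoc, hqq]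
  have he₁₁ := he₁.isIdempotentElem.eq
  have he₂₂ := he₂.isIdempotentElem.eq
  obtain ⟨hpe₁, he₁p⟩ := hIp e₁ he₁I
  have h12 : e₁ * e₂ = 0 := by
    rw [← he₁p, ← hqe₂, mul_assoc, ← mul_assoc p, hpq, zero_mul, mul_zero]
  have h21 : e₂ * e₁ = 0 := by
    rw [← hpe₁, ← he₂q, mul_assoc, ← mul_assoc q, hqp, zero_mul, mul_zero]
  set f := e₁ + e₂ with hf_def
  have hf : IsStarProjection f := he₁.add he₂ h12
  have hfe : ‖f - e‖ ≤ 15 * ε := by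
    have h1 : f - e = (e₁ - s) + (s - p * e * p) + (e₂ - q * e * q) + p * (e * p - p * e) * 1
        + q * (e * q - q * e) * 1 := by
      have h2 : p * (e * p - p * e) * 1 + q * (e * q - q * e) * 1
          = p * e * p + q * e * q - (p * p * e + q * q * e) := by noncomm_ring
      have h3 : p * p * e + q * q * e = e := by
        rw [hpp, hqq, ← add_mul, hq_def, add_sub_cancel, one_mul]
      rw [add_assoc, h2, h3, hf_def]; abel
    have h4 := hb _ hp.norm_le (b := 1) h1n hep
    have h5 := hb _ hq.norm_le (b := 1) h1n heq
    rw [h1]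
    refine (norm_add_le _ _).trans ?_
    have h6 := norm_add₄_le (a := e₁ - s) (b := s - p * e * p) (c := e₂ - q * e * q)
      (d := p * (e * p - p * e) * 1)
    linarith
  set r := p - e₁ with hr_def
  set t := q - e₂ with ht_def
  have hr : IsStarProjection r := he₁.sub_of_mul_eq_right hp hpe₁
  have ht : IsStarProjection t := he₂.sub_of_mul_eq_right hq hqe₂
  have hrr := hr.isIdempotentElem.eq
  have htt := ht.isIdempotentElem.eq
  have hff := hf.isIdempotentElem.eq
  have hpe₂ : p * e₂ = 0 := by rw [← hqe₂, ← mul_assoc, hpq, zero_mul]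
  have he₂p : e₂ * p = 0 := by rw [← he₂q, mul_assoc, hqp, mul_zero]
  have hqe₁ : q * e₁ = 0 := by rw [← hpe₁, ← mul_assoc, hqp, zero_mul]
  have he₁q : e₁ * q = 0 := by rw [← he₁p, mul_assoc, hpq, mul_zero]
  have hrt : r * t = 0 := by
    simp only [hr_def, ht_def, mul_sub, sub_mul, hpq, hpe₂, he₁q, h12]; simp
  have htr : t * r = 0 := by
    simp only [hr_def, ht_def, mul_sub, sub_mul, hqp, he₂p, hqe₁, h21]; simp
  have hrf : r * f = 0 := by
    simp only [hr_def, hf_def, mul_add, sub_mul, hpe₁, hpe₂, he₁₁, h12]; simp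
  have hfr : f * r = 0 := by
    simp only [hr_def, hf_def, add_mul, mul_sub, he₁p, he₂p, he₁₁, h21]; simp
  have htf : t * f = 0 := by
    simp only [ht_def, hf_def, mul_add, sub_mul, hqe₁, hqe₂, he₂₂, h21]; simp
  have hft : f * t = 0 := by
    simp only [ht_def, hf_def, add_mul, mul_sub, he₁q, he₂q, he₂₂, h12]; simp
  have hre₁ : r * e₁ = 0 := by rw [hr_def, sub_mul, hpe₁, he₁₁, sub_self]
  have he₁r : e₁ * r = 0 := by rw [hr_def, mul_sub, he₁p, he₁₁, sub_self]
  have hsum : r + t + f = 1 := by simp only [hr_def, ht_def, hf_def, hq_def]; abel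
  have hrp : r * p = r := by rw [hr_def, sub_mul, hpp, he₁p]
  have hpr : p * r = r := by rw [hr_def, mul_sub, hpp, hpe₁]
  have hqt : q * t = t := by rw [ht_def, mul_sub, hqq, hqe₂]
  have htq : t * q = t := by rw [ht_def, sub_mul, hqq, he₂q]
  have hrI : r ∈ I := sub_mem hpI he₁I
  -- `c` is close to the block-diagonal element `r c r + t c t`.
  have hdiag : ‖r * c * r + t * c * t - c‖ ≤ 32 * K * ε := by
    have h1 : r * c * r + t * c * t - c = -(1 * (f - e) * c + (r + t) * (c * (f - e)) * 1
        + r * (c * p - p * c) * t * (-1) + t * (c * p - p * c) * r) := by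
      have h2 : r * (c * p - p * c) * t = - (r * c * t) := by
        have : r * (c * p - p * c) * t = r * c * (p * t) - (r * p) * c * t := by noncomm_ring
        rw [this, hrp, ← hqt, ← mul_assoc p, hpq]; simp
      have h3 : t * (c * p - p * c) * r = t * c * r := by
        have : t * (c * p - p * c) * r = t * c * (p * r) - (t * p) * c * r := by noncomm_ring
        rw [this, hpr, ← htq, mul_assoc t q p, hqp]; simp
      have h4 : c = (r + t + f) * c * (r + t + f) := by rw [hsum]; simp
      have h5 : f * c = f * c * (r + t + f) := by rw [hsum, mul_one]
      rw [h2, h3]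
      simp only [mul_sub, sub_mul, hce, hec, one_mul, mul_one, sub_zero]
      rw [h5]
      nth_rw 3 [h4]
      noncomm_ring
    have hc : ‖c‖ ≤ K := by linarith
    have hrt1 : ‖r + t‖ ≤ 1 := (hr.add ht hrt).norm_le
    have h2 : ‖1 * (f - e) * c‖ ≤ 15 * ε * K := by
      rw [one_mul]
      exact (norm_mul_le _ _).trans (by gcongr)
    have h3 : ‖(r + t) * (c * (f - e)) * 1‖ ≤ K * (15 * ε) :=
      hb _ hrt1 h1n ((norm_mul_le _ _).trans (by gcongr))
    have h4 : ‖r * (c * p - p * c) * t * (-1)‖ ≤ ε := by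
      rw [mul_neg, mul_one, norm_neg]; exact hb _ hr.norm_le ht.norm_le hcp
    have h5 : ‖t * (c * p - p * c) * r‖ ≤ ε := hb _ ht.norm_le hr.norm_le hcp
    rw [h1, norm_neg]
    refine norm_add₄_le.trans ?_
    nlinarith
  -- An invertible element of the corner `r A r` close to `r c r`.
  obtain ⟨y, z, hry, hyr, hrz, hzr, hyz, hzy, hyc⟩ : ∃ y z : A, r * y = y ∧ y * r = y ∧ r * z = z ∧
      z * r = z ∧ y * z = r ∧ z * y = r ∧ ‖y - r * c * r‖ ≤ 4 * ε := by
    obtain ⟨c₀, hc₀, hpc₀⟩ := happ c (by simp)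
    obtain ⟨Y, hY, Z, hZ, hYZ, hZY, hYx⟩ := hI.exists_near_invertible hIc hpI hIp
      (add_mem (mul_mem (mul_mem hrI hc₀) hrI) he₁I) hε
    have hp' : r + e₁ = p := sub_add_cancel _ _
    obtain ⟨y, z, hry, hyr, hrz, hzr, hyz, hzy, hyx⟩ := exists_corner_invertible_near hr he₁ hre₁
      he₁r (x := r * c₀ * r) (by simp only [← mul_assoc, hrr]) (by simp only [mul_assoc, hrr])
      (by rw [hp', (hIp Y hY).2]) (by rw [hp', (hIp Z hZ).2]) (by rw [hp', hYZ]) (by rw [hp', hZY])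
      (η := ε) (by rw [norm_sub_rev]; exact hYx.le) (by linarith)
    refine ⟨y, z, hry, hyr, hrz, hzr, hyz, hzy, ?_⟩
    have h1 : y - r * c * r = (y - r * c₀ * r) - r * (p * c * p - c₀) * r := by
      have : r * (p * c * p - c₀) * r = (r * p) * c * (p * r) - r * c₀ * r := by noncomm_ring
      rw [this, hrp, hpr]; abel
    rw [h1]
    refine (norm_sub_le _ _).trans ?_
    have := hb _ hr.norm_le hr.norm_le hpc₀.le
    nlinarith
  -- A comparison of `t` with a part of `f`, through `q ≼ e`.
  obtain ⟨V, W, hfV, hVt, htW, hWf, hWV, hV, hW⟩ : ∃ V W : A, f * V = V ∧ V * t = V ∧ t * W = W ∧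
      W * f = W ∧ W * V = t ∧ ‖V‖ ≤ 1 ∧ ‖W‖ ≤ 2 := by
    obtain ⟨g, hg, hge, hqg⟩ := hsub
    obtain ⟨v, hv, hgv⟩ := hqg.exists_star_mul_self hq hg
    have hev : e * v = v := by
      have h0 : (1 - e) * e = 0 := by rw [sub_mul, one_mul, hee, sub_self]
      have h1 : (1 - e) * g = 0 := mul_eq_zero_of_mem_closure_left h0 hge
      have h2 : e * g = g := by rw [sub_mul, one_mul, sub_eq_zero] at h1; exact h1.symm
      rw [← hgv, ← mul_assoc, h2]
    have hvn : ‖v‖ ≤ 1 := norm_le_one_of_isStarProjection_star_mul_self (hv ▸ hq)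
    have hVn : ‖f * v * t‖ ≤ 1 := hb v hf.norm_le ht.norm_le hvn
    have hWn : ‖t * star v * f‖ ≤ 1 := hb _ ht.norm_le hf.norm_le (by rwa [norm_star])
    obtain ⟨d, htd, hdt, -, hdw, hdn⟩ := exists_corner_inverse
      (w := t * star v * f * (f * v * t)) ht
      (by simp only [← mul_assoc, htt]) (by simp only [mul_assoc, htt]) (by
        have h1 : t * star v * f * (f * v * t) - t = (t * star v) * (f - e) * (v * t) := by
          have h2 : t * star v * f * (f * v * t) = t * star v * (f * f) * v * t := by noncomm_ring
          have h3 : t * star v * (f - e) * (v * t)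
              = t * star v * f * v * t - t * star v * (e * v) * t := by noncomm_ring
          have h4 : t * star v * v * t = t := by rw [mul_assoc t, hv, htq, htt]
          rw [h2, h3, hff, hev, h4]
        rw [h1]
        refine (hb (f - e) ?_ ?_ hfe).trans (by linarith)
        · exact (norm_mul_le_of_norm_le_one_left ht.norm_le _).trans (by rwa [norm_star])
        · exact (norm_mul_le_of_norm_le_one_right _ ht.norm_le).trans hvn)
    refine ⟨f * v * t, d * (t * star v * f), ?_, ?_, ?_, ?_, ?_, hVn, ?_⟩
    · simp only [← mul_assoc, hff]
    · simp only [mul_assoc, htt]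
    · rw [← mul_assoc, htd]
    · simp only [mul_assoc, hff]
    · rw [mul_assoc, hdw]
    · exact (norm_mul_le_of_norm_le_one_right _ hWn).trans hdn
  refine ⟨_, isUnit_of_corner_swap hff hft htf hfr hrf hrt htr hsum hry hyr hrz hzr hyz hzy
    (C := t * c * t) (by simp only [← mul_assoc, htt]) (by simp only [mul_assoc, htt])
    hfV hVt htW hWf hWV (δ := ((δ / 12 : ℝ) : ℂ)) (by exact_mod_cast (by positivity)), ?_⟩
  rw [dist_comm, dist_eq_norm]
  have h1 : y + t * c * t + ((δ / 12 : ℝ) : ℂ) • (V + W) + ((δ / 12 : ℝ) : ℂ) • (f - V * W) - c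
      = (y - r * c * r) + (r * c * r + t * c * t - c) + ((δ / 12 : ℝ) : ℂ) • (V + W)
        + ((δ / 12 : ℝ) : ℂ) • (f - V * W) := by abel
  rw [h1]
  refine norm_add₄_le.trans_lt ?_
  rw [norm_smul, norm_smul, Complex.norm_real, Real.norm_of_nonneg (by positivity)]
  have h2 : ‖V + W‖ ≤ 3 := (norm_add_le _ _).trans (by linarith)
  have h3 : ‖f - V * W‖ ≤ 3 := by
    have := norm_mul_le_of_norm_le_one_left hV W
    have := norm_sub_le f (V * W)
    linarith [hf.norm_le]
  have h4 : δ / 12 * ‖V + W‖ ≤ δ / 12 * 3 := by gcongr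
  have h5 : δ / 12 * ‖f - V * W‖ ≤ δ / 12 * 3 := by gcongr
  nlinarith

/-! ### Reduction to annihilated elements -/

/-- The element `h` is a bump function of `star a * a`, concentrated near `0`. -/
theorem exists_norm_mul_le_of_not_isUnit_star_mul_self {A : Type*} [CStarAlgebra A]
    [PartialOrder A] [StarOrderedRing A] {a : A} (ha : ¬ IsUnit (star a * a)) {η : ℝ}
    (hη : 0 < η) : ∃ h : A, ‖h‖ = 1 ∧ ‖a * h‖ ≤ η := by
  let f : ℝ → ℝ := fun t => max 0 (1 - t / η ^ 2)
  have hf : Continuous f := by fun_prop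
  have hH : IsSelfAdjoint (star a * a) := .star_mul_self a
  have hspec : ∀ t ∈ spectrum ℝ (star a * a), 0 ≤ t := fun t ht =>
    spectrum_nonneg_of_nonneg (star_mul_self_nonneg a) ht
  have h0 : (0 : ℝ) ∈ spectrum ℝ (star a * a) := spectrum.zero_mem_iff ℝ |>.mpr ha
  have hf1 : ∀ t ∈ spectrum ℝ (star a * a), |f t| ≤ 1 := fun t ht => by
    rw [abs_of_nonneg (le_max_left _ _)]
    have := div_nonneg (hspec t ht) (sq_nonneg η)
    exact max_le zero_le_one (by linarith)
  refine ⟨cfc f (star a * a), le_antisymm (norm_cfc_le zero_le_one hf1) ?_, ?_⟩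
  · have := norm_apply_le_norm_cfc f (star a * a) h0
    simpa [f] using this
  · refine le_of_sq_le_sq ?_ hη.le
    have h1 : star (a * cfc f (star a * a)) * (a * cfc f (star a * a))
        = cfc (fun t => f t * t * f t) (star a * a) := by
      rw [cfc_mul (fun t => f t * t) f (star a * a), cfc_mul f (fun t => t) (star a * a),
        cfc_id' ℝ (star a * a), star_mul, (cfc_predicate f (star a * a)).star_eq]
      simp only [mul_assoc]
    rw [sq, ← CStarRing.norm_star_mul_self, h1]
    refine norm_cfc_le (by positivity) fun t ht => ?_
    have ht0 := hspec t ht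
    have hft : 0 ≤ f t := le_max_left _ _
    have hft1 : f t ≤ 1 := (le_abs_self _).trans (hf1 t ht)
    rw [Real.norm_of_nonneg (by positivity)]
    rcases le_total t (η ^ 2) with h | h
    · calc f t * t * f t ≤ 1 * t * 1 := by gcongr
        _ ≤ η ^ 2 := by simpa using h
    · have : f t = 0 := max_eq_left (by
        have := (one_le_div (by positivity : 0 < η ^ 2)).mpr h
        linarith)
      rw [this, mul_zero]
      positivity

/-- If `star a * a` is not invertible, then, up to a unitary and a small perturbation, `a` has a
nonzero positive two-sided annihilator `k`. The compression `p a p` is close to an invertible `y ∈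
I`, and `y` is small on `p h p`, where `‖h‖ = 1` and `a h` is small: here the lower bound on `‖p h
p‖` in the definition of TAI algebras enters. In the polar decomposition `y + q = u B` the
positive part `B` therefore has spectrum near `0`, and cutting off that part of the spectrum
leaves room for `k`. -/
theorem exists_unitary_mul_near_annihilated {A : Type*} [CStarAlgebra A] [PartialOrder A]
    [StarOrderedRing A] (hsimple : IsSimpleCStar A) (hTAI : IsTAI A) {a : A}
    (ha : ¬ IsUnit (star a * a)) {κ : ℝ} (hκ : 0 < κ) (hκ1 : κ ≤ 1 / 2) :
    ∃ u ∈ unitary A, ∃ c k : A, 0 ≤ k ∧ k ≠ 0 ∧ c * k = 0 ∧ k * c = 0 ∧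
      ‖star u * a - c‖ ≤ 2 * κ := by
  classical
  have _ := hsimple.1
  set K := ‖a‖ with hK
  have hK0 : 0 ≤ K := norm_nonneg a
  obtain ⟨h, hh1, hah⟩ := exists_norm_mul_le_of_not_isUnit_star_mul_self ha
    (show 0 < κ / 4 by positivity)
  -- The errors below sum to at most `κ / 2` in `hyh` and to at most `2 κ` in the final estimate.
  obtain ⟨ε, hε, hε1⟩ : ∃ ε : ℝ, 0 < ε ∧ (4 + K) * ε ≤ κ / 4 :=
    ⟨κ / 4 / (4 + K), by positivity, by field_simp; rfl⟩
  have hKε : 0 ≤ K * ε := by positivity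
  have hh0 : h ≠ 0 := by rintro rfl; simp at hh1
  obtain ⟨p, hp, -, I, hIc, hI, hpI, hIp, hcomm, happ, hphp, -, -⟩ := hTAI {a, h} h (by simp) hh0
    ε hε 1 one_pos 1 zero_le_one (hsimple.isFull one_ne_zero)
  set q := 1 - p with hq_def
  have hq : IsStarProjection q := hp.one_sub
  have hpp := hp.isIdempotentElem.eq
  have hqq := hq.isIdempotentElem.eq
  have hpq : p * q = 0 := by rw [hq_def, mul_sub, mul_one, hpp, sub_self]
  have hqp : q * p = 0 := by rw [hq_def, sub_mul, one_mul, hpp, sub_self]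
  have hpq1 : p + q = 1 := add_sub_cancel _ _
  have hb : ∀ {a b : A} (x : A) {η : ℝ}, ‖a‖ ≤ 1 → ‖b‖ ≤ 1 → ‖x‖ ≤ η → ‖a * x * b‖ ≤ η :=
    fun x _ ha hb hx => ((norm_mul_le_of_norm_le_one_right _ hb).trans
      (norm_mul_le_of_norm_le_one_left ha _)).trans hx
  have hap : ‖a * p - p * a‖ ≤ ε := (hcomm a (by simp)).le
  have hhp : ‖h * p - p * h‖ ≤ ε := (hcomm h (by simp)).le
  obtain ⟨y, hy, z, hz, hyz, hzy, hya⟩ : ∃ y ∈ I, ∃ z ∈ I, y * z = p ∧ z * y = p ∧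
      ‖y - p * a * p‖ ≤ 2 * ε := by
    obtain ⟨a₁, ha₁, hpa⟩ := happ a (by simp)
    obtain ⟨y, hy, z, hz, hyz, hzy, hay⟩ := hI.exists_near_invertible hIc hpI hIp ha₁ hε
    refine ⟨y, hy, z, hz, hyz, hzy, ?_⟩
    rw [norm_sub_rev]
    have := norm_sub_le_norm_sub_add_norm_sub (p * a * p) a₁ y
    linarith
  obtain ⟨hpy, hyp⟩ := hIp y hy
  obtain ⟨hpz, hzp⟩ := hIp z hz
  have hyq : y * q = 0 := by rw [← hyp, mul_assoc, hpq, mul_zero]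
  have hqy : q * y = 0 := by rw [← hpy, ← mul_assoc, hqp, zero_mul]
  have hzq : z * q = 0 := by rw [← hzp, mul_assoc, hpq, mul_zero]
  have hqz : q * z = 0 := by rw [← hpz, ← mul_assoc, hqp, zero_mul]
  have hyh : ‖y * (p * h * p)‖ ≤ κ / 2 := by
    have h1 : y * (p * h * p) = (y - p * a * p) * (p * h * p)
        + p * (a * h * p - a * (h * p - p * h)) * p := by
      have h2 : p * (a * h * p - a * (h * p - p * h)) * p = p * a * p * h * p := by
        simp only [mul_sub, ← mul_assoc, sub_sub_cancel]
      have h3 : p * a * p * (p * h * p) = p * a * (p * p) * h * p := by simp only [mul_assoc]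
      rw [h2, sub_mul, h3, hpp, sub_add_cancel]
    have hhn : ‖p * h * p‖ ≤ 1 := hb h hp.norm_le hp.norm_le hh1.le
    have h4 := norm_mul_le_of_norm_le_one_right (y - p * a * p) hhn
    have h5 : ‖a * h * p - a * (h * p - p * h)‖ ≤ κ / 4 + K * ε := by
      refine (norm_sub_le _ _).trans (add_le_add ?_ ?_)
      · exact (norm_mul_le_of_norm_le_one_right _ hp.norm_le).trans hah
      · exact (norm_mul_le _ _).trans (by gcongr)
    rw [h1]
    refine (norm_add_le _ _).trans ?_
    have := hb _ hp.norm_le hp.norm_le h5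
    linarith
  -- Polar decomposition `y + q = u B` of an invertible element.
  have hY : IsUnit (y + q) := by
    refine isUnit_iff_exists.mpr ⟨z + q, ?_, ?_⟩
    · simp only [mul_add, add_mul, hyz, hyq, hqz, hqq, zero_add, add_zero, hpq1]
    · simp only [mul_add, add_mul, hzy, hzq, hqy, hqq, zero_add, add_zero, hpq1]
  have hYq : (y + q) * q = q := by rw [add_mul, hyq, hqq, zero_add]
  have hqY : q * (y + q) = q := by rw [mul_add, hqy, hqq, zero_add]
  have hsYq : star (y + q) * q = q := by
    have := congrArg star hqY
    rwa [star_mul, hq.isSelfAdjoint.star_eq] at this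
  set B := CFC.abs (y + q) with hB_def
  have hB0 : 0 ≤ B := CFC.abs_nonneg _
  have hBsa : IsSelfAdjoint B := hB0.isSelfAdjoint
  have hBB : B * B = star (y + q) * (y + q) := CFC.abs_mul_abs _
  have hBu : IsUnit B := (Commute.refl B).isUnit_mul_iff.mp (hBB ▸ hY.star.mul hY) |>.1
  have hBq : B * q = q := by
    have hc : Commute (y + q) q := hYq.trans hqY.symm
    have := hc.cfcAbs_mul_eq (by rwa [hq.isSelfAdjoint.star_eq])
    rwa [hYq, CFC.abs_of_nonneg q hq.nonneg, eq_comm] at this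
  obtain ⟨b, hb_eq⟩ := hBu
  have hbq : (↑b⁻¹ : A) * q = q := by
    conv_lhs => rw [← hBq, ← hb_eq, ← mul_assoc, b.inv_mul, one_mul]
  have hsb : star (↑b⁻¹ : A) = ↑b⁻¹ := by
    have h1 : star b = b := Units.ext (by rw [Units.coe_star, hb_eq, hBsa.star_eq])
    rw [← Units.coe_star_inv, h1]
  set u := (y + q) * ↑b⁻¹ with hu_def
  have hsu : star u * (y + q) = B := by
    rw [hu_def, star_mul, hsb, mul_assoc, ← hBB, ← hb_eq, ← mul_assoc, b.inv_mul, one_mul]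
  have hsuq : star u * q = q := by rw [hu_def, star_mul, hsb, mul_assoc, hsYq, hbq]
  have huu : u ∈ unitary A := by
    have h1 : star u * u = 1 := by
      nth_rw 2 [hu_def]
      rw [← mul_assoc, hsu, ← hb_eq, b.mul_inv]
    obtain ⟨w, hw⟩ := (hY.mul b⁻¹.isUnit).exists_right_inv
    exact Unitary.mem_iff.mpr ⟨h1, left_inv_eq_right_inv h1 hw ▸ hw⟩
  -- Cut the spectrum of `B` at `κ`.
  let f : ℝ → ℝ := fun t => max 0 (κ - t)
  let g : ℝ → ℝ := fun t => max 0 (t - κ)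
  let m : ℝ → ℝ := fun t => f t / max (1 - t) (1 / 2)
  let j : ℝ → ℝ := fun t => (max t κ)⁻¹
  have hf : Continuous f := by fun_prop
  have hg : Continuous g := by fun_prop
  have hm : Continuous m := hf.div₀ (by fun_prop) fun t => (lt_max_of_lt_right (by norm_num)).ne'
  have hj : Continuous j := Continuous.inv₀ (by fun_prop) fun t => (lt_max_of_lt_right hκ).ne'
  have hfg : ∀ t, f t * g t = 0 := fun t => by
    rcases le_total t κ with h | h
    · simp [g, h]
    · simp [f, h]
  have hfm : ∀ t, f t = m t * (1 - t) := fun t => by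
    rcases le_total t κ with h | h
    · simp only [m]
      rw [max_eq_left (by linarith), div_mul_cancel₀ _ (by linarith)]
    · simp [m, f, h]
  have hjf : ∀ t, j t * t = 1 - κ⁻¹ * f t := fun t => by
    rcases le_total t κ with h | h
    · simp only [j, f]
      rw [max_eq_right h, max_eq_right (by linarith)]
      field_simp
      ring
    · simp only [j, f]
      rw [max_eq_left h, max_eq_left (by linarith), mul_zero, sub_zero,
        inv_mul_cancel₀ (by linarith)]
  set k := cfc f B with hk_def
  set D := cfc g B with hD_def
  have hkD : k * D = 0 := by
    rw [hk_def, hD_def, ← cfc_mul f g B hf.continuousOn hg.continuousOn]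
    simp only [hfg, cfc_const_zero]
  have hDk : D * k = 0 := by rw [← hkD]; exact cfc_commute_cfc g f B
  -- `k` kills `q`, since `B = 1` on `q` and `f` vanishes at `1`.
  have hkq : k * q = 0 := by
    have h1 : k = cfc m B * (1 - B) := by
      rw [hk_def, cfc_congr (g := fun t => m t * (1 - t)) fun t _ => hfm t,
        cfc_mul m (fun t => 1 - t) B hm.continuousOn (by fun_prop),
        cfc_sub (fun _ => 1) (fun t => t) B (by fun_prop) (by fun_prop), cfc_const_one ℝ B hBsa,
        cfc_id' ℝ B hBsa]
    rw [h1, mul_assoc, sub_mul, one_mul, hBq, sub_self, mul_zero]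
  have hk0 : 0 ≤ k := cfc_nonneg fun t _ => le_max_left _ _
  have hqk : q * k = 0 := by
    have := congrArg star hkq
    rwa [star_mul, star_zero, hk0.isSelfAdjoint.star_eq, hq.isSelfAdjoint.star_eq] at this
  have hpk : p * k = k := by rw [← sub_eq_zero, ← neg_sub, ← one_sub_mul, hqk, neg_zero]
  refine ⟨u, huu, D * p + q * a * q, k, hk0, ?_, ?_, ?_, ?_⟩
  · -- If `k = 0`, then `B ≥ κ`, but `B` is small on the nonzero element `p h p`.
    intro hk
    have h1 : cfc j B * B = 1 := by
      have h2 : cfc (fun t => j t * t) B = cfc j B * B := by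
        rw [cfc_mul j (fun t => t) B hj.continuousOn (by fun_prop), cfc_id' ℝ B hBsa]
      rw [← h2, cfc_congr (g := fun t => 1 - κ⁻¹ * f t) fun t _ => hjf t,
        cfc_sub (fun _ => 1) (fun t => κ⁻¹ * f t) B (by fun_prop) (by fun_prop),
        cfc_const_one ℝ B hBsa, cfc_const_mul κ⁻¹ f B hf.continuousOn, ← hk_def, hk, smul_zero,
        sub_zero]
    have h3 : ‖cfc j B‖ ≤ κ⁻¹ := norm_cfc_le (by positivity) fun t _ => by
      rw [Real.norm_of_nonneg (inv_nonneg.mpr (le_max_of_le_right hκ.le))]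
      exact inv_anti₀ hκ (le_max_right _ _)
    have h4 : B * (p * h * p) = star u * (y * (p * h * p)) := by
      rw [← hsu, mul_assoc, add_mul, ← mul_assoc q, ← mul_assoc q, hqp]
      simp
    have h5 : ‖B * (p * h * p)‖ ≤ κ / 2 := by
      rw [h4]
      refine (norm_mul_le_of_norm_le_one_left ?_ _).trans hyh
      rw [norm_star]
      exact (CStarRing.norm_of_mem_unitary huu).le
    have h6 : ‖p * h * p‖ ≤ κ⁻¹ * (κ / 2) := by
      rw [← one_mul (p * h * p), ← h1, mul_assoc]
      exact (norm_mul_le _ _).trans (by gcongr)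
    rw [show κ⁻¹ * (κ / 2) = 1 / 2 by field_simp] at h6
    linarith
  · rw [add_mul, mul_assoc D, hpk, hDk, mul_assoc (q * a), hqk, mul_zero, zero_add]
  · rw [mul_add, ← mul_assoc, hkD, ← mul_assoc, ← mul_assoc, hkq]
    simp
  · have h1 : star u * a - (D * p + q * a * q) = star u * (-(p * (a * p - p * a) * q)
        + q * (a * p - p * a) * p - (y - p * a * p)) + (B - D) * p := by
      have h2 : p * (a * p - p * a) * q = - (p * a * q) := by
        have : p * (a * p - p * a) * q = p * a * (p * q) - p * p * a * q := by noncomm_ring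
        rw [this, hpq, hpp]; simp
      have h3 : q * (a * p - p * a) * p = q * a * p := by
        have : q * (a * p - p * a) * p = q * a * (p * p) - q * p * a * p := by noncomm_ring
        rw [this, hqp, hpp]; simp
      have h4 : B * p = star u * y := by
        have : B = B * p + q := by rw [← hBq, ← mul_add, hpq1, mul_one]
        rw [eq_sub_of_add_eq this.symm, ← hsu, mul_add, hsuq, add_sub_cancel_right]
      have h5 : a = p * a * p + p * a * q + q * a * p + q * a * q := by
        calc a = (p + q) * a * (p + q) := by rw [hpq1]; simp
          _ = _ := by noncomm_ring
      have h6 : star u * (q * a * q) = q * a * q := by rw [← mul_assoc, ← mul_assoc, hsuq]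
      rw [h2, h3, sub_mul B D p, h4]
      nth_rw 1 [h5]
      rw [mul_add (star u) _ (q * a * q), h6]
      noncomm_ring
    have h2 : ‖B - D‖ ≤ κ := by
      rw [hD_def]
      nth_rw 1 [← cfc_id' ℝ B hBsa]
      rw [← cfc_sub (fun t => t) g B (by fun_prop) hg.continuousOn]
      refine norm_cfc_le hκ.le fun t ht => ?_
      have ht0 : 0 ≤ t := spectrum_nonneg_of_nonneg hB0 ht
      rw [Real.norm_eq_abs, abs_le]
      rcases le_total t κ with h | h
      · simp only [g]
        rw [max_eq_left (by linarith)]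
        constructor <;> linarith
      · simp only [g]
        rw [max_eq_right (by linarith)]
        constructor <;> linarith
    have hun : ‖star u‖ ≤ 1 := by rw [norm_star]; exact (CStarRing.norm_of_mem_unitary huu).le
    rw [h1]
    refine (norm_add_le _ _).trans ?_
    have h3 := norm_mul_le_of_norm_le_one_left hun (-(p * (a * p - p * a) * q)
        + q * (a * p - p * a) * p - (y - p * a * p))
    have h4 := norm_mul_le_of_norm_le_one_right (B - D) hp.norm_le
    have h5 := norm_sub_le (-(p * (a * p - p * a) * q) + q * (a * p - p * a) * p) (y - p * a * p)
    have h6 := norm_add_le (-(p * (a * p - p * a) * q)) (q * (a * p - p * a) * p)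
    rw [norm_neg] at h6
    have h7 := hb _ hp.norm_le hq.norm_le hap
    have h8 := hb _ hq.norm_le hp.norm_le hap
    linarith

theorem mem_closure_isUnit_of_annihilated {A : Type*} [CStarAlgebra A] [PartialOrder A]
    [StarOrderedRing A] (hsimple : IsSimpleCStar A) (hTAI : IsTAI A) {c k : A}
    (hk : 0 ≤ k) (hk0 : k ≠ 0) (hck : c * k = 0) (hkc : k * c = 0) :
    c ∈ closure {a : A | IsUnit a} := by
  classical
  by_cases hproj : ∃ e : A, IsStarProjection e ∧ e ≠ 0 ∧
      e ∈ closure (Set.range fun x : A => k * x * k)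
  · obtain ⟨e, he, he0, hek⟩ := hproj
    exact mem_closure_isUnit_of_mul_projection_eq_zero hsimple hTAI he he0
      (mul_eq_zero_of_mem_closure_left hck hek) (mul_eq_zero_of_mem_closure_right hkc hek)
  · -- Without nonzero projections in the hereditary subalgebra of `k`, the unit of `I` is `1`.
    push Not at hproj
    rw [Metric.mem_closure_iff]
    intro δ hδ
    obtain ⟨p, hp, -, I, hIc, hI, hpI, hIp, -, happ, -, -, g, hg, hgk, hsub⟩ :=
      hTAI {c, k} k (by simp) hk0 (δ / 2) (by positivity) 1 one_pos k hk (hsimple.isFull hk0)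
    have hg0 : g = 0 := by_contra fun h => hproj g hg h hgk
    obtain ⟨v, hv, hgv⟩ := hsub.exists_star_mul_self hp.one_sub hg
    have hp1 : p = 1 := by
      rw [hg0, zero_mul] at hgv
      rw [← hgv, mul_zero] at hv
      exact (sub_eq_zero.mp hv.symm).symm
    subst hp1
    obtain ⟨x, hx, hcx⟩ := happ c (by simp)
    obtain ⟨y, -, z, -, hyz, hzy, hxy⟩ := hI.exists_near_invertible hIc hpI hIp hx
      (show 0 < δ / 2 by positivity)
    refine ⟨y, isUnit_iff_exists.mpr ⟨z, hyz, hzy⟩, ?_⟩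
    rw [one_mul, mul_one] at hcx
    rw [dist_eq_norm]
    have := norm_sub_le_norm_sub_add_norm_sub c x y
    linarith

theorem mem_closure_isUnit_of_not_isUnit_star_mul_self {A : Type*} [CStarAlgebra A]
    [PartialOrder A] [StarOrderedRing A] (hsimple : IsSimpleCStar A) (hTAI : IsTAI A) {a : A}
    (ha : ¬ IsUnit (star a * a)) : a ∈ closure {a : A | IsUnit a} := by
  rw [Metric.mem_closure_iff]
  intro δ hδ
  have hκ : 0 < min (1 / 2) (δ / 4) := by positivity
  obtain ⟨u, hu, c, k, hk, hk0, hck, hkc, hc⟩ := exists_unitary_mul_near_annihilated hsimple hTAI ha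
    hκ (min_le_left _ _)
  obtain ⟨x, hx, hcx⟩ := Metric.mem_closure_iff.mp
    (mem_closure_isUnit_of_annihilated hsimple hTAI hk hk0 hck hkc) (δ / 2) (by positivity)
  refine ⟨u * x, (Unitary.isUnit_coe (U := ⟨u, hu⟩)).mul hx, ?_⟩
  have h1 : a - u * x = u * (star u * a - x) := by
    rw [mul_sub, ← mul_assoc, Unitary.mul_star_self_of_mem hu, one_mul]
  rw [dist_eq_norm] at hcx ⊢
  rw [h1, CStarRing.norm_mem_unitary_mul _ hu]
  have h2 := norm_sub_le_norm_sub_add_norm_sub (star u * a) c x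
  have h3 := min_le_right (1 / 2) (δ / 4)
  linarith

end TracialAI

theorem theorem4p5 {A : Type*} [CStarAlgebra A] [PartialOrder A] [StarOrderedRing A]
    (hsimple : TracialAI.IsSimpleCStar A) (hTAI : TracialAI.IsTAI A) :
    TracialAI.HasStableRankOne A := by
  intro a
  by_cases h1 : IsUnit (star a * a)
  · by_cases h2 : IsUnit (star (star a) * star a)
    · obtain ⟨b, hb⟩ := h1.exists_left_inv
      obtain ⟨d, hd⟩ := h2.exists_right_inv
      rw [star_star] at hd
      exact subset_closure (isUnit_iff_exists_and_exists.mpr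
        ⟨⟨_, (mul_assoc _ _ _).symm.trans hd⟩, ⟨_, (mul_assoc _ _ _).trans hb⟩⟩)
    · have h := TracialAI.mem_closure_isUnit_of_not_isUnit_star_mul_self hsimple hTAI h2
      rw [← star_star a]
      exact map_mem_closure continuous_star h fun x hx => IsUnit.star hx
  · exact TracialAI.mem_closure_isUnit_of_not_isUnit_star_mul_self hsimple hTAI h1
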